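/- Let $a<b$ be real numbers and let $f$ be a non-negative $C^1$ function on $[a,b]$ (with one-sided derivatives at the endpoints). Suppose that its mean value is positive, $$\frac{1}{b-a}\int_a^b f = m > 0 .$$ Then $$\frac{2\pi^2}{(b-a)^2}\left(\int_a^b f\log f \;-\; (b-a)\,m\log m\right) \;\le\; \int_a^b \frac{f'^2}{f},$$ where $0\log 0$ is taken to be $0$, the integrand $f'^2/f$ on the right is taken to be $0$ where $f=0$, and the integral on the right is a Lebesgue integral with values in $[0,\infty]$ (for $+\infty$ the inequality holds trivially). -/

import Mathlib

/-!
# The sharp logarithmic Sobolev inequality on an interval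

After scaling, the interval is `[0, π]` and the claim for positive `f` with mean `M` is
`∫ f log f - ∫ f'² / (2f) ≤ π M log M`.

The proof runs the heat flow with Neumann boundary conditions from `f`. The right side is the value
of the left side at infinite time, where the flow has reached the constant `M`, so it is enough that
`∫ f log f - ∫ f'² / (2f)` increases in time. Its time derivative is `∫ f u''² - ∫ f'² / f` with
`u = log f`. In terms of `g = √f`, integration by parts turns it into
`4 ∫ (g''² - g'²) + (4/3) ∫ g'⁴ / g²`, which is nonnegative by the Wirtinger inequality for `g'`,
a function vanishing at both endpoints. The pointwise identity is `hasDerivAt_entropy_flux`, where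
all the integrations by parts are collected in one explicit flux; for it to be smooth at the
endpoints, `f'` has to be divisible by `sin`.

To have an explicit flow, `f` is taken first as a polynomial in `cos x`, that is, a finite cosine
sum: the flow multiplies the `k`-th coefficient by `τ ^ (k ^ 2)`, where `τ = exp (-t)` runs from
`1` down to `0`. Positivity along the flow holds because the solution is a Gaussian average of the
initial datum (`le_heatCosSum`). This gives `logSobolev_heatCosSum`, and approximation in `C⁰` with
boundedly convergent derivatives (`exists_eval_cos_approx`) gives all positive `C¹` functions.
A nonnegative `f` is the limit of `f + ε`, for which the right side of the inequality is smaller.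
-/

/-! ### Differentiation under the integral sign -/

theorem hasDerivAt_intervalIntegral_of_continuousOn {F F' : ℝ → ℝ → ℝ} {U : Set ℝ}
    (hU : IsOpen U) {a b : ℝ} (hab : a ≤ b)
    (hF : ∀ t ∈ U, ContinuousOn (F t) (Set.Icc a b))
    (hF' : ContinuousOn (Function.uncurry F') (U ×ˢ Set.Icc a b))
    (hd : ∀ t ∈ U, ∀ x ∈ Set.Icc a b, HasDerivAt (fun t => F t x) (F' t x) t)
    {t : ℝ} (ht : t ∈ U) :
    HasDerivAt (fun t => ∫ x in a..b, F t x) (∫ x in a..b, F' t x) t := by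
  obtain ⟨r, hr, hrU⟩ := Metric.nhds_basis_closedBall.mem_iff.1 (hU.mem_nhds ht)
  obtain ⟨C, hC⟩ := ((isCompact_closedBall t r).prod isCompact_Icc).exists_bound_of_continuousOn
    (hF'.mono (Set.prod_mono hrU (subset_refl (Set.Icc a b))))
  have hIoc : Set.uIoc a b ⊆ Set.Icc a b := by
    rw [Set.uIoc_of_le hab]; exact Set.Ioc_subset_Icc_self
  have hmeas : ∀ {g : ℝ → ℝ}, ContinuousOn g (Set.Icc a b) →
      MeasureTheory.AEStronglyMeasurable g (MeasureTheory.volume.restrict (Set.uIoc a b)) :=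
    fun hg => (hg.mono hIoc).aestronglyMeasurable measurableSet_uIoc
  refine (intervalIntegral.hasDerivAt_integral_of_dominated_loc_of_deriv_le
    (s := Metric.closedBall t r) (bound := fun _ => C) (F := F) (F' := F')
    (Metric.closedBall_mem_nhds t hr) ?_ ?_ ?_ ?_ ?_ ?_).2
  · filter_upwards [hU.mem_nhds ht] with u hu using hmeas (hF u hu)
  · exact (hF t ht).intervalIntegrable_of_Icc hab
  · refine hmeas (hF'.comp (f := fun x => (t, x)) (by fun_prop) fun x hx => ⟨ht, hx⟩)
  · exact Filter.Eventually.of_forall fun x hx u hu => hC (u, x) ⟨hu, hIoc hx⟩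
  · exact intervalIntegrable_const
  · exact Filter.Eventually.of_forall fun x hx u hu => hd u (hrU hu) x (hIoc hx)

/-! ### Entropy dissipation -/

open Real in
/-- The pointwise identity behind the entropy estimate. Write `f₁, f₂, f₃` for the derivatives of
`f`, and let `f₁ = sin * h`. The first line of the derivative is the time derivative of
`f log f - f₁² / (2f)` along the heat flow. The subtracted terms are nonnegative; the first of them
is `4 sin² w'²`, where `w = v / sin` and `v = (√f)' = sin * h / (2√f)`. It comes from the Wirtinger
inequality `∫ v² ≤ ∫ v'²` in the form `v'² - v² = sin² w'² + (sin cos w²)'`. -/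
theorem hasDerivAt_entropy_flux {f f₁ f₂ h : ℝ → ℝ} {f₃ h' x : ℝ}
    (hf : HasDerivAt f (f₁ x) x) (hf₁ : HasDerivAt f₁ (f₂ x) x) (hf₂ : HasDerivAt f₂ f₃ x)
    (hh : HasDerivAt h h' x) (hfac : ∀ y, f₁ y = sin y * h y) (hpos : 0 < f x) :
    HasDerivAt
      (fun y => f₁ y * (log (f y) + 1) - f₁ y * f₂ y / f y + f₁ y ^ 3 / (6 * f y ^ 2)
        + sin y * cos y * h y ^ 2 / f y)
      (f₂ x * (log (f x) + 1) - f₁ x * f₃ / f x + f₁ x ^ 2 * f₂ x / (2 * f x ^ 2)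
        - (sin x ^ 2 * (h' - h x * f₁ x / (2 * f x)) ^ 2 / f x
          + f₁ x ^ 4 / (12 * f x ^ 3))) x := by
  have e₂ : f₂ x = cos x * h x + sin x * h' := by
    have : HasDerivAt f₁ (cos x * h x + sin x * h') x := by
      rw [funext hfac]; exact (hasDerivAt_sin x).mul hh
    exact hf₁.unique this
  have hne := hpos.ne'
  have hB := (((hf₁.mul ((hf.log hne).add_const 1)).sub ((hf₁.mul hf₂).div hf hne)).add
    ((hf₁.pow 3).div ((hf.pow 2).const_mul 6) (by simpa using hne))).add
    ((((hasDerivAt_sin x).mul (hasDerivAt_cos x)).mul (hh.pow 2)).div hf hne)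
  refine hB.congr_deriv ?_
  simp only [Pi.mul_apply, Pi.pow_apply, e₂, hfac x]
  field_simp
  ring

/-! ### The heat flow on cosine sums -/

theorem hasDerivAt_pow_sq {τ : ℝ} (hτ : τ ≠ 0) (k : ℕ) :
    HasDerivAt (fun t : ℝ => t ^ (k ^ 2)) ((k : ℝ) ^ 2 * τ ^ (k ^ 2) / τ) τ := by
  refine (hasDerivAt_pow (k ^ 2) τ).congr_deriv ?_
  rcases Nat.eq_zero_or_pos k with rfl | hk
  · simp
  · rw [eq_div_iff hτ, mul_assoc, ← pow_succ, Nat.sub_add_cancel (Nat.pow_pos hk), Nat.cast_pow]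

/-- The solution `∑ c k * exp (-k² t) * cos (k x)` of the heat equation with Neumann boundary
conditions on `[0, π]`, in the time variable `τ = exp (-t)`. This runs the flow backwards on
`[0, 1]`: the initial datum is at `τ = 1`, the limit of infinite time is `τ = 0`, and the heat
equation reads `τ * ∂τ f = -∂x² f`. -/
noncomputable def heatCosSum (s : Finset ℕ) (c : ℕ → ℝ) (τ x : ℝ) : ℝ :=
  ∑ k ∈ s, c k * τ ^ (k ^ 2) * Real.cos (k * x)

/-- The sine analogue of `heatCosSum`, which its space derivatives of odd order are made of. -/
noncomputable def heatSinSum (s : Finset ℕ) (c : ℕ → ℝ) (τ x : ℝ) : ℝ :=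
  ∑ k ∈ s, c k * τ ^ (k ^ 2) * Real.sin (k * x)

section HeatSums

variable (s : Finset ℕ) (c : ℕ → ℝ)

theorem continuous_heatCosSum : Continuous (Function.uncurry (heatCosSum s c)) := by
  simp only [heatCosSum, Function.uncurry_def]; fun_prop

theorem continuous_heatSinSum : Continuous (Function.uncurry (heatSinSum s c)) := by
  simp only [heatSinSum, Function.uncurry_def]; fun_prop

theorem hasDerivAt_heatCosSum (τ x : ℝ) :
    HasDerivAt (heatCosSum s c τ) (heatSinSum s (fun k => -(k * c k)) τ x) x := by
  unfold heatCosSum heatSinSum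
  refine HasDerivAt.fun_sum fun k _ => ?_
  refine ((((hasDerivAt_id x).const_mul (k : ℝ)).cos).const_mul (c k * τ ^ (k ^ 2))).congr_deriv ?_
  simp only [id]; ring

theorem hasDerivAt_heatSinSum (τ x : ℝ) :
    HasDerivAt (heatSinSum s c τ) (heatCosSum s (fun k => k * c k) τ x) x := by
  unfold heatCosSum heatSinSum
  refine HasDerivAt.fun_sum fun k _ => ?_
  refine ((((hasDerivAt_id x).const_mul (k : ℝ)).sin).const_mul (c k * τ ^ (k ^ 2))).congr_deriv ?_
  simp only [id]; ring

theorem hasDerivAt_heatCosSum_time {τ : ℝ} (hτ : τ ≠ 0) (x : ℝ) :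
    HasDerivAt (fun t => heatCosSum s c t x) (heatCosSum s (fun k => k ^ 2 * c k) τ x / τ) τ := by
  unfold heatCosSum
  rw [Finset.sum_div]
  refine HasDerivAt.fun_sum fun k _ => ?_
  refine (((hasDerivAt_pow_sq hτ k).const_mul (c k)).mul_const
    (Real.cos (k * x))).congr_deriv ?_
  ring

theorem hasDerivAt_heatSinSum_time {τ : ℝ} (hτ : τ ≠ 0) (x : ℝ) :
    HasDerivAt (fun t => heatSinSum s c t x) (heatSinSum s (fun k => k ^ 2 * c k) τ x / τ) τ := by
  unfold heatSinSum
  rw [Finset.sum_div]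
  refine HasDerivAt.fun_sum fun k _ => ?_
  refine (((hasDerivAt_pow_sq hτ k).const_mul (c k)).mul_const
    (Real.sin (k * x))).congr_deriv ?_
  ring

/-- The factor is a combination of the Chebyshev polynomials `U (k - 1)` evaluated at `cos x`. -/
theorem exists_heatSinSum_eq_sin_mul (τ : ℝ) :
    ∃ h h' : ℝ → ℝ, (∀ x, HasDerivAt h (h' x) x) ∧
      ∀ x, heatSinSum s c τ x = Real.sin x * h x := by
  let Q : Polynomial ℝ :=
    ∑ k ∈ s, Polynomial.C (c k * τ ^ (k ^ 2)) * Polynomial.Chebyshev.U ℝ ((k : ℤ) - 1)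
  refine ⟨fun x => Q.eval (Real.cos x), fun x => Q.derivative.eval (Real.cos x) * -Real.sin x,
    fun x => (Q.hasDerivAt _).comp x (Real.hasDerivAt_cos x), fun x => ?_⟩
  simp only [Q, heatSinSum, Polynomial.eval_finsetSum, Finset.mul_sum, Polynomial.eval_mul,
    Polynomial.eval_C]
  refine Finset.sum_congr rfl fun k _ => ?_
  have := Polynomial.Chebyshev.U_real_cos x ((k : ℤ) - 1)
  push_cast at this
  rw [sub_add_cancel] at this
  rw [← this]; ring

/-- At infinite time the solution is the mean value of the initial datum. -/
theorem heatCosSum_zero (x : ℝ) :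
    heatCosSum s c 0 x = Real.pi⁻¹ * ∫ y in (0)..Real.pi, heatCosSum s c 1 y := by
  unfold heatCosSum
  rw [intervalIntegral.integral_finsetSum
    (fun k _ => Continuous.intervalIntegrable (by fun_prop) _ _), Finset.mul_sum]
  refine Finset.sum_congr rfl fun k _ => ?_
  rw [intervalIntegral.integral_const_mul]
  rcases Nat.eq_zero_or_pos k with rfl | hk
  · simp; field_simp
  · have hk' : (k : ℝ) ≠ 0 := by positivity
    simp [hk.ne', intervalIntegral.integral_comp_mul_left (fun x => Real.cos x) hk']

theorem heatSinSum_zero (x : ℝ) : heatSinSum s c 0 x = 0 := by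
  unfold heatSinSum
  refine Finset.sum_eq_zero fun k _ => ?_
  rcases Nat.eq_zero_or_pos k with rfl | hk
  · simp
  · simp [hk.ne']

open MeasureTheory ProbabilityTheory in
theorem integral_cos_gaussianReal (x : ℝ) (v : NNReal) (k : ℝ) :
    ∫ z, Real.cos (k * z) ∂gaussianReal x v = Real.exp (-(v * k ^ 2 / 2)) * Real.cos (k * x) := by
  have h := charFun_gaussianReal (μ := x) (v := v) k
  rw [charFun_apply_real] at h
  have hint : Integrable (fun z : ℝ => Complex.exp (k * z * Complex.I)) (gaussianReal x v) := by
    refine (integrable_const (1 : ℝ)).mono' (by fun_prop) (Filter.Eventually.of_forall fun z => ?_)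
    rw [← Complex.ofReal_mul, Complex.norm_exp_ofReal_mul_I]
  have h2 := congrArg Complex.re h
  rw [← Complex.reCLM_apply, ← ContinuousLinearMap.integral_comp_comm _ hint] at h2
  have e1 : ∀ z : ℝ, Complex.reCLM (Complex.exp (k * z * Complex.I)) = Real.cos (k * z) := by
    intro z; rw [← Complex.ofReal_mul, Complex.reCLM_apply, Complex.exp_ofReal_mul_I_re]
  simp only [e1] at h2
  rw [h2, Complex.exp_re]
  simp [pow_two]

open MeasureTheory ProbabilityTheory in
/-- The heat flow preserves lower bounds: the solution at time `t = -log τ` is the average of the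
initial datum against the Gaussian law with mean `x` and variance `2 t`. -/
theorem le_heatCosSum {δ : ℝ} (hδ : ∀ x, δ ≤ heatCosSum s c 1 x) {τ : ℝ}
    (hτ : τ ∈ Set.Icc (0 : ℝ) 1) (x : ℝ) : δ ≤ heatCosSum s c τ x := by
  have key : ∀ t ∈ Set.Ioc (0 : ℝ) 1, δ ≤ heatCosSum s c t x := by
    intro t ht
    have hlog : 0 ≤ -(2 * Real.log t) := by
      linarith [Real.log_nonpos ht.1.le ht.2]
    let v : NNReal := ⟨-(2 * Real.log t), hlog⟩
    have hint : ∀ k : ℕ, Integrable (fun z : ℝ => c k * 1 ^ (k ^ 2) * Real.cos (k * z))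
        (gaussianReal x v) := fun k =>
      ((integrable_const (1 : ℝ)).mono' (by fun_prop)
        (Filter.Eventually.of_forall fun z => Real.abs_cos_le_one _)).const_mul _
    have e : ∫ z, heatCosSum s c 1 z ∂gaussianReal x v = heatCosSum s c t x := by
      unfold heatCosSum
      rw [integral_finsetSum _ fun k _ => hint k]
      refine Finset.sum_congr rfl fun k _ => ?_
      rw [integral_const_mul, integral_cos_gaussianReal]
      have : Real.exp (-((v : ℝ) * (k : ℝ) ^ 2 / 2)) = t ^ (k ^ 2) := by
        have hv : (v : ℝ) = -(2 * Real.log t) := rfl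
        rw [hv, show -(-(2 * Real.log t) * (k : ℝ) ^ 2 / 2) = ((k ^ 2 : ℕ) : ℝ) * Real.log t by
          push_cast; ring, Real.exp_nat_mul, Real.exp_log ht.1]
      rw [this]; ring
    rw [← e]
    have : ∫ _z, δ ∂gaussianReal x v = δ := by simp
    rw [← this]
    exact integral_mono (integrable_const _) (integrable_finsetSum _ fun k _ => hint k) hδ
  rcases hτ.1.eq_or_lt with rfl | h0
  · have hc : Continuous fun t => heatCosSum s c t x := by unfold heatCosSum; fun_prop
    refine ge_of_tendsto (hc.continuousWithinAt (s := Set.Ioi 0) (x := 0)) ?_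
    filter_upwards [Ioc_mem_nhdsGT (zero_lt_one' ℝ)] with t ht using key t ht
  · exact key τ ⟨h0, hτ.2⟩

end HeatSums

/-! ### The inequality for positive cosine polynomials -/

open Real in
/-- The integrated form of `hasDerivAt_entropy_flux`: the flux vanishes at `0` and `π` because both
`sin` and `f₁` do. -/
theorem intervalIntegral_entropy_flow_nonneg {f f₁ f₂ f₃ h h' : ℝ → ℝ}
    (hf : ∀ x, HasDerivAt f (f₁ x) x) (hf₁ : ∀ x, HasDerivAt f₁ (f₂ x) x)
    (hf₂ : ∀ x, HasDerivAt f₂ (f₃ x) x) (hf₃ : Continuous f₃)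
    (hh : ∀ x, HasDerivAt h (h' x) x) (hfac : ∀ y, f₁ y = sin y * h y) (hpos : ∀ x, 0 < f x) :
    0 ≤ ∫ x in (0)..π, (f₂ x * (log (f x) + 1) - f₁ x * f₃ x / f x
      + f₁ x ^ 2 * f₂ x / (2 * f x ^ 2)) := by
  have cf : Continuous f := continuous_iff_continuousAt.2 fun x => (hf x).continuousAt
  have cf₁ : Continuous f₁ := continuous_iff_continuousAt.2 fun x => (hf₁ x).continuousAt
  have cf₂ : Continuous f₂ := continuous_iff_continuousAt.2 fun x => (hf₂ x).continuousAt
  have hne : ∀ x, f x ≠ 0 := fun x => (hpos x).ne'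
  have cK : Continuous fun x => f₂ x * (log (f x) + 1) - f₁ x * f₃ x / f x
      + f₁ x ^ 2 * f₂ x / (2 * f x ^ 2) := by
    have : ∀ x, 2 * f x ^ 2 ≠ 0 := fun x => by simpa using hne x
    fun_prop (disch := assumption)
  have hB := fun x => hasDerivAt_entropy_flux (hf x) (hf₁ x) (hf₂ x) (hh x) hfac (hpos x)
  set K : ℝ → ℝ := fun x => f₂ x * (log (f x) + 1) - f₁ x * f₃ x / f x
      + f₁ x ^ 2 * f₂ x / (2 * f x ^ 2) with hK
  have := intervalIntegral.sub_le_integral_of_hasDeriv_right_of_le pi_pos.le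
    (continuous_iff_continuousAt.2 fun x => (hB x).continuousAt).continuousOn
    (fun x _ => (hB x).hasDerivWithinAt)
    (φ := K) (cK.integrableOn_Icc) (fun x _ => by
      have := hpos x
      simp only [hK]
      refine sub_le_self _ ?_
      positivity)
  simpa [hfac] using this

open Real in
/-- The two sides are the values at `τ = 1` and `τ = 0` of `∫ f log f - f'² / (2f)`, which is
antitone in `τ`. -/
theorem logSobolev_heatCosSum (s : Finset ℕ) (c : ℕ → ℝ) {δ : ℝ} (hδ : 0 < δ)
    (hc : ∀ x, δ ≤ heatCosSum s c 1 x) :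
    ∫ x in (0)..π, (heatCosSum s c 1 x * log (heatCosSum s c 1 x)
        - heatSinSum s (fun k => -(k * c k)) 1 x ^ 2 / (2 * heatCosSum s c 1 x))
      ≤ π * ((π⁻¹ * ∫ x in (0)..π, heatCosSum s c 1 x)
          * log (π⁻¹ * ∫ x in (0)..π, heatCosSum s c 1 x)) := by
  set c₁ : ℕ → ℝ := fun k => -(k * c k)
  set c₂ : ℕ → ℝ := fun k => k * c₁ k
  set c₃ : ℕ → ℝ := fun k => -(k * c₂ k)
  have hpos : ∀ t ∈ Set.Icc (0 : ℝ) 1, ∀ x, 0 < heatCosSum s c t x := fun t ht x =>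
    hδ.trans_le (le_heatCosSum s c hc ht x)
  set F : ℝ → ℝ → ℝ := fun t x => heatCosSum s c t x * log (heatCosSum s c t x)
        - heatSinSum s c₁ t x ^ 2 / (2 * heatCosSum s c t x) with hF
  set K : ℝ → ℝ → ℝ := fun t x => heatCosSum s c₂ t x * (log (heatCosSum s c t x) + 1)
      - heatSinSum s c₁ t x * heatSinSum s c₃ t x / heatCosSum s c t x
      + heatSinSum s c₁ t x ^ 2 * heatCosSum s c₂ t x / (2 * heatCosSum s c t x ^ 2) with hK
  have ccos : ∀ (c : ℕ → ℝ) t, Continuous (heatCosSum s c t) := fun c t => by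
    unfold heatCosSum; fun_prop
  have csin : ∀ (c : ℕ → ℝ) t, Continuous (heatSinSum s c t) := fun c t => by
    unfold heatSinSum; fun_prop
  have hKnn : ∀ t ∈ Set.Ioo (0 : ℝ) 1, 0 ≤ ∫ x in (0)..π, K t x := fun t ht => by
    obtain ⟨h, h', hh, hfac⟩ := exists_heatSinSum_eq_sin_mul s c₁ t
    exact intervalIntegral_entropy_flow_nonneg (hasDerivAt_heatCosSum s c t)
      (hasDerivAt_heatSinSum s c₁ t) (hasDerivAt_heatCosSum s c₂ t) (csin c₃ t) hh hfac
      (hpos t (Set.Ioo_subset_Icc_self ht))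
  have hder : ∀ t ∈ Set.Ioo (0 : ℝ) 1,
      HasDerivAt (fun t => ∫ x in (0)..π, F t x) (∫ x in (0)..π, -(K t x / t)) t := fun t ht => by
    refine hasDerivAt_intervalIntegral_of_continuousOn (F := F)
      (F' := fun t x => -(K t x / t)) (U := Set.Ioo 0 1) isOpen_Ioo pi_pos.le
      ?_ ?_ ?_ ht
    · intro u hu
      have h0 : ∀ x, heatCosSum s c u x ≠ 0 := fun x =>
        (hpos u (Set.Ioo_subset_Icc_self hu) x).ne'
      have h1 : ∀ x, 2 * heatCosSum s c u x ≠ 0 := fun x => by simpa using h0 x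
      have := ccos c u
      have := csin c₁ u
      exact Continuous.continuousOn (by fun_prop (disch := assumption))
    · have h0 : ∀ p ∈ Set.Ioo (0 : ℝ) 1 ×ˢ Set.Icc 0 π, heatCosSum s c p.1 p.2 ≠ 0 := fun p hp =>
        (hpos p.1 (Set.Ioo_subset_Icc_self hp.1) p.2).ne'
      have h1 : ∀ p ∈ Set.Ioo (0 : ℝ) 1 ×ˢ Set.Icc 0 π, 2 * heatCosSum s c p.1 p.2 ^ 2 ≠ 0 :=
        fun p hp => by simpa using h0 p hp
      have h2 : ∀ p ∈ Set.Ioo (0 : ℝ) 1 ×ˢ Set.Icc 0 π, p.1 ≠ 0 := fun p hp => hp.1.1.ne'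
      have k0 : ContinuousOn (fun p : ℝ × ℝ => heatCosSum s c p.1 p.2)
        (Set.Ioo (0 : ℝ) 1 ×ˢ Set.Icc 0 π) := (continuous_heatCosSum s c).continuousOn
      have k1 : ContinuousOn (fun p : ℝ × ℝ => heatSinSum s c₁ p.1 p.2)
        (Set.Ioo (0 : ℝ) 1 ×ˢ Set.Icc 0 π) := (continuous_heatSinSum s c₁).continuousOn
      have k2 : ContinuousOn (fun p : ℝ × ℝ => heatCosSum s c₂ p.1 p.2)
        (Set.Ioo (0 : ℝ) 1 ×ˢ Set.Icc 0 π) := (continuous_heatCosSum s c₂).continuousOn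
      have k3 : ContinuousOn (fun p : ℝ × ℝ => heatSinSum s c₃ p.1 p.2)
        (Set.Ioo (0 : ℝ) 1 ×ˢ Set.Icc 0 π) := (continuous_heatSinSum s c₃).continuousOn
      simp only [hK, Function.uncurry_def]
      fun_prop (disch := assumption)
    · intro u hu x _
      have hp := hpos u (Set.Ioo_subset_Icc_self hu) x
      have d0 := hasDerivAt_heatCosSum_time s c hu.1.ne' x
      have d1 := hasDerivAt_heatSinSum_time s c₁ hu.1.ne' x
      have e2 : heatCosSum s (fun k => k ^ 2 * c k) u x = -heatCosSum s c₂ u x := by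
        simp only [heatCosSum, ← Finset.sum_neg_distrib, c₂, c₁]
        exact Finset.sum_congr rfl fun k _ => by ring
      have e3 : heatSinSum s (fun k => k ^ 2 * c₁ k) u x = -heatSinSum s c₃ u x := by
        simp only [heatSinSum, ← Finset.sum_neg_distrib, c₃, c₂]
        exact Finset.sum_congr rfl fun k _ => by ring
      rw [e2] at d0
      rw [e3] at d1
      have hu0 := hu.1.ne'
      refine ((d0.mul (d0.log hp.ne')).sub
        ((d1.pow 2).div (d0.const_mul 2) (by simpa using hp.ne'))).congr_deriv ?_
      simp only [hK, Pi.pow_apply]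
      field_simp
      ring
  -- Positivity holds only for `τ ∈ [0, 1]`, so `τ` is clamped to get a globally continuous integrand.
  have hcont : ContinuousOn (fun t => ∫ x in (0)..π, F t x) (Set.Icc 0 1) := by
    let g : ℝ → ℝ := fun t => max 0 (min t 1)
    have hg : Continuous g := by fun_prop
    have hgm : ∀ t, g t ∈ Set.Icc (0 : ℝ) 1 := fun t =>
      ⟨le_max_left _ _, max_le zero_le_one (min_le_right _ _)⟩
    have h0 : ∀ p : ℝ × ℝ, heatCosSum s c (g p.1) p.2 ≠ 0 := fun p => (hpos _ (hgm p.1) p.2).ne'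
    have h1 : ∀ p : ℝ × ℝ, 2 * heatCosSum s c (g p.1) p.2 ≠ 0 := fun p => by simpa using h0 p
    have k0 : Continuous (fun p : ℝ × ℝ => heatCosSum s c (g p.1) p.2) :=
      (continuous_heatCosSum s c).comp (f := fun p : ℝ × ℝ => (g p.1, p.2)) (by fun_prop)
    have k1 : Continuous (fun p : ℝ × ℝ => heatSinSum s c₁ (g p.1) p.2) :=
      (continuous_heatSinSum s c₁).comp (f := fun p : ℝ × ℝ => (g p.1, p.2)) (by fun_prop)
    have : Continuous fun t => ∫ x in (0)..π, F (g t) x := by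
      refine intervalIntegral.continuous_parametric_intervalIntegral_of_continuous' ?_ _ _
      simp only [hF, Function.uncurry_def]
      fun_prop (disch := assumption)
    refine this.continuousOn.congr fun t ht => ?_
    have : g t = t := by simp [g, ht.1, ht.2]
    simp only [this]
  have hanti : AntitoneOn (fun t => ∫ x in (0)..π, F t x) (Set.Icc 0 1) := by
    refine antitoneOn_of_deriv_nonpos (convex_Icc 0 1) hcont ?_ ?_ <;> rw [interior_Icc]
    · exact fun t ht => (hder t ht).differentiableAt.differentiableWithinAt
    · intro t ht
      rw [(hder t ht).deriv, intervalIntegral.integral_neg, intervalIntegral.integral_div]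
      exact neg_nonpos.2 (div_nonneg (hKnn t ht) ht.1.le)
  refine (hanti (by simp) (by simp) zero_le_one).trans_eq ?_
  simp only [hF, heatCosSum_zero, heatSinSum_zero]
  simp [mul_left_comm]

theorem exists_heatCosSum_eq_eval_cos (Q : Polynomial ℝ) :
    ∃ (s : Finset ℕ) (c : ℕ → ℝ), ∀ x, Q.eval (Real.cos x) = heatCosSum s c 1 x := by
  let v : ℕ → ℝ → ℝ := fun k x => Real.cos (k * x)
  have hv : ∀ k, (fun x => Real.cos x * v k x) ∈ Submodule.span ℝ (Set.range v) := by
    intro k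
    rcases k with _ | k
    · refine Submodule.subset_span ⟨1, ?_⟩
      ext x; simp [v]
    · have : (fun x => Real.cos x * v (k + 1) x) = (1 / 2 : ℝ) • v (k + 2) + (1 / 2 : ℝ) • v k := by
        ext x
        simp only [v, Pi.add_apply, Pi.smul_apply, smul_eq_mul]
        push_cast
        rw [show ((k : ℝ) + 2) * x = (k + 1) * x + x by ring,
          show (k : ℝ) * x = (k + 1) * x - x by ring, Real.cos_add, Real.cos_sub]
        ring
      rw [this]
      exact add_mem (Submodule.smul_mem _ _ (Submodule.subset_span ⟨_, rfl⟩))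
        (Submodule.smul_mem _ _ (Submodule.subset_span ⟨_, rfl⟩))
  have hmul : ∀ g ∈ Submodule.span ℝ (Set.range v),
      (fun x => Real.cos x * g x) ∈ Submodule.span ℝ (Set.range v) := by
    intro g hg
    induction hg using Submodule.span_induction with
    | mem g hg => obtain ⟨k, rfl⟩ := hg; exact hv k
    | zero => simp only [Pi.zero_apply, mul_zero]; exact Submodule.zero_mem _
    | add g₁ g₂ _ _ h₁ h₂ => convert add_mem h₁ h₂ using 1; ext x; simp [mul_add]
    | smul a g _ h => convert Submodule.smul_mem _ a h using 1; ext x; simp; ring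
  have hQ : (fun x => Q.eval (Real.cos x)) ∈ Submodule.span ℝ (Set.range v) := by
    induction Q using Polynomial.induction_on with
    | C a =>
      convert Submodule.smul_mem (Submodule.span ℝ (Set.range v)) a
        (Submodule.subset_span ⟨0, rfl⟩) using 1
      ext x; simp [v]
    | add p q hp hq => convert add_mem hp hq using 1; ext x; simp
    | monomial n a h => convert hmul _ h using 1; ext x; simp [pow_succ]; ring
  obtain ⟨c, hc⟩ := (Finsupp.mem_span_range_iff_exists_finsupp).1 hQ
  refine ⟨c.support, c, fun x => ?_⟩
  have := congrFun hc x
  simp only [Finsupp.sum, Finset.sum_apply, Pi.smul_apply, smul_eq_mul, v] at this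
  simp [heatCosSum, this]

open Real in
theorem logSobolev_eval_cos {Q : Polynomial ℝ} {p' : ℝ → ℝ}
    (hp' : ∀ x, HasDerivAt (fun y => Q.eval (cos y)) (p' x) x)
    {δ : ℝ} (hδ : 0 < δ) (hQ : ∀ x, δ ≤ Q.eval (cos x)) :
    ∫ x in (0)..π, (Q.eval (cos x) * log (Q.eval (cos x)) - p' x ^ 2 / (2 * Q.eval (cos x)))
      ≤ π * ((π⁻¹ * ∫ x in (0)..π, Q.eval (cos x)) * log (π⁻¹ * ∫ x in (0)..π, Q.eval (cos x))) := by
  obtain ⟨s, c, hsc⟩ := exists_heatCosSum_eq_eval_cos Q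
  have e : p' = heatSinSum s (fun k => -(k * c k)) 1 := by
    ext x
    refine (hp' x).unique ?_
    rw [funext hsc]
    exact hasDerivAt_heatCosSum s c 1 x
  simp only [hsc, e] at hQ ⊢
  exact logSobolev_heatCosSum s c hδ hQ

/-! ### Approximation by cosine polynomials -/

theorem Polynomial.exists_derivative_eq (q : Polynomial ℝ) : ∃ R : Polynomial ℝ, R.derivative = q := by
  induction q using Polynomial.induction_on' with
  | add p q hp hq =>
    obtain ⟨R, rfl⟩ := hp
    obtain ⟨S, rfl⟩ := hq
    exact ⟨R + S, Polynomial.derivative_add⟩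
  | monomial n a =>
    refine ⟨Polynomial.monomial (n + 1) (a / (n + 1)), ?_⟩
    rw [Polynomial.derivative_monomial]
    have : (n : ℝ) + 1 ≠ 0 := by positivity
    simp [div_mul_cancel₀ _ this]

open Real Filter Topology in
/-- A `C¹` function is a limit on `[0, π]` of polynomials in `cos x`, uniformly, with derivatives
that are bounded and converge in the interior. The derivatives cannot converge at the endpoints in
general, since those of polynomials in `cos x` vanish there. -/
theorem exists_eval_cos_approx {f f' : ℝ → ℝ} (hf : ∀ x, HasDerivAt f (f' x) x)
    (hf' : Continuous f') :
    ∃ (Q : ℕ → Polynomial ℝ) (d : ℕ → ℝ → ℝ) (C : ℝ),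
      (∀ n x, HasDerivAt (fun y => (Q n).eval (cos y)) (d n x) x) ∧
      (∀ n, Continuous (d n)) ∧ (∀ n, ∀ x ∈ Set.Icc 0 π, |d n x| ≤ C) ∧
      (∀ x ∈ Set.Ioo 0 π, Tendsto (fun n => d n x) atTop (𝓝 (f' x))) ∧
      TendstoUniformlyOn (fun n x => (Q n).eval (cos x)) f atTop (Set.Icc 0 π) := by
  obtain ⟨C, hC⟩ := isCompact_Icc.exists_bound_of_continuousOn
    (hf'.continuousOn (s := Set.Icc 0 π))
  simp only [norm_eq_abs] at hC
  -- `sin x * k n x` is `f' x` cut off near the endpoints, so that it is divisible by `sin x`.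
  let k : ℕ → ℝ → ℝ := fun n x => f' x * (n / max 1 (n * sin x))
  have hk : ∀ n, Continuous (k n) := fun n => by
    have : ∀ x, max 1 (n * sin x) ≠ 0 := fun x => (lt_max_of_lt_left one_pos).ne'
    fun_prop (disch := assumption)
  have hq : ∀ n : ℕ, ∃ q : Polynomial ℝ, ∀ x ∈ Set.Icc 0 π,
      |q.eval (cos x) - k n x| < 1 / ((n : ℝ) + 1) := fun n => by
    obtain ⟨q, hq⟩ := exists_polynomial_near_of_continuousOn (-1) 1 (fun y => k n (arccos y))
      ((hk n).comp continuous_arccos).continuousOn (1 / ((n : ℝ) + 1)) (by positivity)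
    refine ⟨q, fun x hx => ?_⟩
    have := hq (cos x) (cos_mem_Icc x)
    simpa only [arccos_cos hx.1 hx.2] using this
  choose q hq using hq
  choose R hR using fun n => (q n).exists_derivative_eq
  let d : ℕ → ℝ → ℝ := fun n x => sin x * (q n).eval (cos x)
  let Q : ℕ → Polynomial ℝ := fun n => Polynomial.C (f 0 + (R n).eval 1) - R n
  have hQ : ∀ n x, HasDerivAt (fun y => (Q n).eval (cos y)) (d n x) x := fun n x => by
    refine (((Q n).hasDerivAt _).comp x (hasDerivAt_cos x)).congr_deriv ?_
    simp only [Q, d, Polynomial.derivative_sub, Polynomial.derivative_C, hR, Polynomial.eval_sub,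
      Polynomial.eval_zero]
    ring
  have hd : ∀ n, Continuous (d n) := fun n => by
    have := (q n).continuous
    fun_prop
  have herr : ∀ n : ℕ, ∀ x ∈ Set.Icc 0 π,
      |d n x - f' x * (n * sin x / max 1 (n * sin x))| ≤ 1 / ((n : ℝ) + 1) := fun n x hx => by
    have e : d n x - f' x * (n * sin x / max 1 (n * sin x))
        = sin x * ((q n).eval (cos x) - k n x) := by simp only [d, k]; ring
    rw [e, abs_mul]
    exact (mul_le_of_le_one_left (abs_nonneg _) (abs_sin_le_one x)).trans (hq n x hx).le
  have hdC : ∀ n, ∀ x ∈ Set.Icc 0 π, |d n x| ≤ C + 1 := fun n x hx => by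
    have h1 := herr n x hx
    have hs : 0 ≤ n * sin x := mul_nonneg n.cast_nonneg (sin_nonneg_of_mem_Icc hx)
    have h2 : |n * sin x / max 1 (n * sin x)| ≤ 1 := by
      rw [abs_of_nonneg (by positivity)]
      exact div_le_one_of_le₀ (le_max_right _ _) (by positivity)
    have h3 : |f' x * (n * sin x / max 1 (n * sin x))| ≤ C := by
      rw [abs_mul]
      exact (mul_le_of_le_one_right (abs_nonneg _) h2).trans (hC x hx)
    have h4 : 1 / ((n : ℝ) + 1) ≤ 1 := by
      rw [div_le_one (by positivity)]; linarith [n.cast_nonneg (α := ℝ)]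
    have := abs_sub_abs_le_abs_sub (d n x) (f' x * (n * sin x / max 1 (n * sin x)))
    linarith
  have hdlim : ∀ x ∈ Set.Ioo 0 π, Tendsto (fun n => d n x) atTop (𝓝 (f' x)) := fun x hx => by
    have hs : 0 < sin x := sin_pos_of_mem_Ioo hx
    have h1 : Tendsto (fun n : ℕ => d n x - f' x) atTop (𝓝 0) := by
      refine squeeze_zero_norm' ?_ tendsto_one_div_add_atTop_nhds_zero_nat
      obtain ⟨N, hN⟩ := exists_nat_ge (1 / sin x)
      filter_upwards [eventually_ge_atTop N] with n hn
      have h2 : 1 ≤ n * sin x := by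
        rw [div_le_iff₀ hs] at hN
        exact hN.trans (by gcongr)
      have := herr n x (Set.Ioo_subset_Icc_self hx)
      rwa [max_eq_right h2, div_self (by positivity), mul_one] at this
    simpa using h1.add_const (f' x)
  refine ⟨Q, d, C + 1, hQ, hd, hdC, hdlim, ?_⟩
  have hη : Tendsto (fun n => ∫ x in (0)..π, |d n x - f' x|) atTop (𝓝 0) := by
    have h0 : ∫ _x in (0)..π, (0 : ℝ) = 0 := intervalIntegral.integral_zero
    nth_rewrite 2 [← h0]
    refine intervalIntegral.tendsto_integral_filter_of_dominated_convergence (fun _ => C + 1 + C)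
      (Eventually.of_forall fun n => ?_) (Eventually.of_forall fun n => ?_) intervalIntegrable_const ?_
    · have := hd n
      exact Continuous.aestronglyMeasurable (by fun_prop)
    · refine Eventually.of_forall fun x hx => ?_
      rw [Set.uIoc_of_le pi_pos.le] at hx
      have hx' := Set.Ioc_subset_Icc_self hx
      rw [norm_eq_abs, abs_abs]
      exact (abs_sub _ _).trans (add_le_add (hdC n x hx') (hC x hx'))
    · filter_upwards [MeasureTheory.Measure.ae_ne MeasureTheory.volume π] with x hxπ hx
      rw [Set.uIoc_of_le pi_pos.le] at hx
      simpa using ((hdlim x ⟨hx.1, lt_of_le_of_ne hx.2 hxπ⟩).sub_const (f' x)).abs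
  rw [Metric.tendstoUniformlyOn_iff]
  intro ε hε
  filter_upwards [(tendsto_order.1 hη).2 ε hε] with n hn x hx
  have hdn := hd n
  have e : (Q n).eval (cos x) - f x = ∫ t in (0)..x, (d n t - f' t) := by
    rw [intervalIntegral.integral_eq_sub_of_hasDerivAt (f := fun t => (Q n).eval (cos t) - f t)
      (fun t _ => (hQ n t).sub (hf t)) (Continuous.intervalIntegrable (by fun_prop) _ _)]
    simp [Q]
  rw [dist_comm, dist_eq, e]
  refine lt_of_le_of_lt ?_ hn
  refine (intervalIntegral.abs_integral_le_integral_abs hx.1).trans ?_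
  exact intervalIntegral.integral_mono_interval le_rfl hx.1 hx.2
    (Eventually.of_forall fun t => abs_nonneg _) (Continuous.intervalIntegrable (by fun_prop) _ _)

/-! ### The inequality for positive functions -/

open Real Filter Topology in
theorem logSobolev_zero_pi {f f' : ℝ → ℝ} (hf : ∀ x, HasDerivAt f (f' x) x)
    (hf' : Continuous f') (hpos : ∀ x ∈ Set.Icc 0 π, 0 < f x) :
    ∫ x in (0)..π, (f x * log (f x) - f' x ^ 2 / (2 * f x))
      ≤ π * ((π⁻¹ * ∫ x in (0)..π, f x) * log (π⁻¹ * ∫ x in (0)..π, f x)) := by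
  obtain ⟨Q, d, C, hQ, hd, hdC, hdlim, hunif⟩ := exists_eval_cos_approx hf hf'
  have cf : Continuous f := continuous_iff_continuousAt.2 fun x => (hf x).continuousAt
  have hne : (Set.Icc 0 π).Nonempty := Set.nonempty_Icc.2 pi_pos.le
  obtain ⟨x₀, hx₀, hmin⟩ := isCompact_Icc.exists_isMinOn hne cf.continuousOn
  obtain ⟨B, hB⟩ := isCompact_Icc.exists_bound_of_continuousOn (cf.continuousOn (s := Set.Icc 0 π))
  obtain ⟨δ, hδ, hδ'⟩ : ∃ δ, 0 < δ ∧ f x₀ = 2 * δ :=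
    ⟨f x₀ / 2, half_pos (hpos x₀ hx₀), by ring⟩
  have cp : ∀ n, Continuous fun x => (Q n).eval (cos x) := fun n =>
    (Q n).continuous.comp continuous_cos
  have hev : ∀ᶠ n in atTop, ∀ x ∈ Set.Icc 0 π, (Q n).eval (cos x) ∈ Set.Icc δ (B + δ) := by
    filter_upwards [Metric.tendstoUniformlyOn_iff.1 hunif δ hδ] with n hn x hx
    have h1 := abs_lt.1 (hn x hx)
    have h2 : f x₀ ≤ f x := hmin hx
    have h3 := (abs_le.1 (hB x hx)).2
    constructor <;> linarith [h1.1, h1.2]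
  let G : ℝ × ℝ → ℝ := fun z => z.1 * log z.1 - z.2 ^ 2 / (2 * z.1)
  have hG : ∀ z : ℝ × ℝ, 0 < z.1 → ContinuousAt G z := fun z hz => by
    have h1 : z.1 ≠ 0 := hz.ne'
    have h2 : 2 * z.1 ≠ 0 := by simpa using h1
    fun_prop (disch := assumption)
  obtain ⟨D, hD⟩ := ((isCompact_Icc (a := δ) (b := B + δ)).prod
    (isCompact_Icc (a := -C) (b := C))).exists_bound_of_continuousOn (f := G)
    fun z hz => (hG z (hδ.trans_le hz.1.1)).continuousWithinAt
  have hlim : Tendsto (fun n => ∫ x in (0)..π, G ((Q n).eval (cos x), d n x)) atTop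
      (𝓝 (∫ x in (0)..π, G (f x, f' x))) := by
    refine intervalIntegral.tendsto_integral_filter_of_dominated_convergence (fun _ => D)
      (hev.mono fun n hn => ?_) (hev.mono fun n hn => ?_) (by simp) ?_
    · refine ContinuousOn.aestronglyMeasurable (fun x hx => ?_) measurableSet_uIoc
      rw [Set.uIoc_of_le pi_pos.le] at hx
      have := (hG ((Q n).eval (cos x), d n x)
        (hδ.trans_le (hn x (Set.Ioc_subset_Icc_self hx)).1))
      exact (this.comp (f := fun x => ((Q n).eval (cos x), d n x))
        ((cp n).prodMk (hd n)).continuousAt).continuousWithinAt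
    · refine Eventually.of_forall fun x hx => ?_
      rw [Set.uIoc_of_le pi_pos.le] at hx
      have hx' := Set.Ioc_subset_Icc_self hx
      exact hD _ ⟨hn x hx', abs_le.1 (hdC n x hx')⟩
    · filter_upwards [MeasureTheory.Measure.ae_ne MeasureTheory.volume π] with x hxπ hx
      rw [Set.uIoc_of_le pi_pos.le] at hx
      have hx' := Set.Ioc_subset_Icc_self hx
      exact (hG (f x, f' x) (hpos x hx')).tendsto.comp
        ((hunif.tendsto_at hx').prodMk_nhds (hdlim x ⟨hx.1, lt_of_le_of_ne hx.2 hxπ⟩))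
  have hmass : Tendsto (fun n => ∫ x in (0)..π, (Q n).eval (cos x)) atTop
      (𝓝 (∫ x in (0)..π, f x)) := by
    refine intervalIntegral.tendsto_integral_filter_of_dominated_convergence (fun _ => B + δ)
      (Eventually.of_forall fun n => (cp n).aestronglyMeasurable) (hev.mono fun n hn => ?_)
      (by simp) (Eventually.of_forall fun x hx => ?_)
    · refine Eventually.of_forall fun x hx => ?_
      rw [Set.uIoc_of_le pi_pos.le] at hx
      have := hn x (Set.Ioc_subset_Icc_self hx)
      rw [norm_eq_abs, abs_of_pos (hδ.trans_le this.1)]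
      exact this.2
    · rw [Set.uIoc_of_le pi_pos.le] at hx
      exact hunif.tendsto_at (Set.Ioc_subset_Icc_self hx)
  have hrhs := ((continuous_mul_log.tendsto _).comp (hmass.const_mul π⁻¹)).const_mul π
  refine le_of_tendsto_of_tendsto hlim hrhs (hev.mono fun n hn => ?_)
  refine logSobolev_eval_cos (hQ n) hδ fun x => ?_
  have := (hn (arccos (cos x)) ⟨arccos_nonneg _, arccos_le_pi _⟩).1
  rwa [cos_arccos (neg_one_le_cos x) (cos_le_one x)] at this

open Real in
theorem logSobolev_Icc_of_pos {a b : ℝ} (hab : a < b) {f f' : ℝ → ℝ}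
    (hf : ∀ x, HasDerivAt f (f' x) x) (hf' : Continuous f') (hpos : ∀ x ∈ Set.Icc a b, 0 < f x) :
    2 * π ^ 2 / (b - a) ^ 2 * ((∫ x in a..b, f x * log (f x)) - (b - a) *
        (((b - a)⁻¹ * ∫ x in a..b, f x) * log ((b - a)⁻¹ * ∫ x in a..b, f x)))
      ≤ ∫ x in a..b, f' x ^ 2 / f x := by
  have hL : 0 < b - a := sub_pos.2 hab
  have cf : Continuous f := continuous_iff_continuousAt.2 fun x => (hf x).continuousAt
  set r : ℝ := (b - a) / π with hr
  have hr0 : 0 < r := by positivity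
  have hrπ : r * π = b - a := by rw [hr]; field_simp
  have h := logSobolev_zero_pi (f := fun y => f (a + r * y)) (f' := fun y => r * f' (a + r * y))
    (fun y => by
      refine ((hf (a + r * y)).comp y (((hasDerivAt_id y).const_mul r).const_add a)).congr_deriv ?_
      simp [mul_comm])
    (by fun_prop)
    (fun y hy => hpos _ ⟨by nlinarith [hy.1], by nlinarith [hy.2]⟩)
  rw [intervalIntegral.integral_comp_add_mul
      (fun x => f x * log (f x) - (r * f' x) ^ 2 / (2 * f x)) hr0.ne' a,
    intervalIntegral.integral_comp_add_mul f hr0.ne' a] at h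
  simp only [mul_zero, add_zero, hrπ, add_sub_cancel, smul_eq_mul] at h
  have e1 : π⁻¹ * (r⁻¹ * ∫ x in a..b, f x) = (b - a)⁻¹ * ∫ x in a..b, f x := by
    rw [← hrπ]; field_simp
  rw [e1] at h
  have hne : ∀ x ∈ Set.uIcc a b, f x ≠ 0 := fun x hx => by
    rw [Set.uIcc_of_le hab.le] at hx; exact (hpos x hx).ne'
  have e2 : ∫ x in a..b, (f x * log (f x) - (r * f' x) ^ 2 / (2 * f x))
      = (∫ x in a..b, f x * log (f x)) - r ^ 2 / 2 * ∫ x in a..b, f' x ^ 2 / f x := by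
    rw [← intervalIntegral.integral_const_mul, ← intervalIntegral.integral_sub]
    · refine intervalIntegral.integral_congr fun x hx => ?_
      have := hne x hx
      field_simp
    · exact (ContinuousOn.intervalIntegrable (by fun_prop (disch := assumption)))
    · exact (ContinuousOn.intervalIntegrable (by fun_prop (disch := assumption)))
  rw [e2, inv_mul_le_iff₀ hr0, ← mul_assoc, hrπ] at h
  have e3 : 2 * π ^ 2 / (b - a) ^ 2 = 2 / r ^ 2 := by rw [← hrπ]; field_simp
  rw [e3, div_mul_eq_mul_div, div_le_iff₀ (by positivity)]
  linarith

/-! ### Nonnegative functions -/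

open Set in
/-- A `C¹` function on a compact interval extends to a `C¹` function on the line. -/
theorem exists_hasDerivAt_extension {a b : ℝ} (hab : a < b) {f : ℝ → ℝ}
    (hf : ContDiffOn ℝ 1 f (Icc a b)) :
    ∃ F F' : ℝ → ℝ, (∀ x, HasDerivAt F (F' x) x) ∧ Continuous F' ∧
      (∀ x ∈ Icc a b, F x = f x) ∧ ∀ x ∈ Icc a b, F' x = derivWithin f (Icc a b) x := by
  have hg : ContinuousOn (derivWithin f (Icc a b)) (Icc a b) :=
    hf.continuousOn_derivWithin (uniqueDiffOn_Icc hab) le_rfl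
  let G : ℝ → ℝ := IccExtend hab.le ((Icc a b).domRestrict (derivWithin f (Icc a b)))
  have hG : Continuous G := (continuousOn_iff_continuous_domRestrict.1 hg).Icc_extend'
  have hGe : ∀ x ∈ Icc a b, G x = derivWithin f (Icc a b) x := fun x hx =>
    IccExtend_of_mem hab.le _ hx
  refine ⟨fun x => f a + ∫ t in a..x, G t, G, fun x => ?_, hG, fun x hx => ?_, hGe⟩
  · exact (intervalIntegral.integral_hasDerivAt_right (hG.intervalIntegrable _ _)
      (hG.stronglyMeasurableAtFilter _ _) hG.continuousAt).const_add (f a)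
  · have := intervalIntegral.integral_eq_sub_of_hasDerivAt_of_le hx.1 (f := f) (f' := G)
      (hf.continuousOn.mono (Icc_subset_Icc_right hx.2)) (fun t ht => ?_)
      (hG.intervalIntegrable _ _)
    · simp only [this]; ring
    · have htm : t ∈ Ioo a b := ⟨ht.1, ht.2.trans_le hx.2⟩
      rw [hGe t (Ioo_subset_Icc_self htm)]
      exact ((hf.differentiableOn one_ne_zero t
        (Ioo_subset_Icc_self htm)).hasDerivWithinAt).hasDerivAt (Icc_mem_nhds htm.1 htm.2)

open MeasureTheory in
/-- Where `f` vanishes in the interior it has a minimum, so `f' = 0` and the integrand on the right,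
which is `0` there by the convention on division by zero, is no loss. -/
theorem ofReal_integral_le_lintegral_div {a b : ℝ} (hab : a < b) {f f' : ℝ → ℝ}
    (hf : ∀ x, HasDerivAt f (f' x) x) (hf' : Continuous f')
    (hnn : ∀ x ∈ Set.Icc a b, 0 ≤ f x) {ε : ℝ} (hε : 0 < ε) :
    ENNReal.ofReal (∫ x in a..b, f' x ^ 2 / (f x + ε))
      ≤ ∫⁻ x in Set.Icc a b, ENNReal.ofReal (f' x ^ 2 / f x) := by
  have cf : Continuous f := continuous_iff_continuousAt.2 fun x => (hf x).continuousAt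
  have hpos : ∀ x ∈ Set.Icc a b, 0 < f x + ε := fun x hx => add_pos_of_nonneg_of_pos (hnn x hx) hε
  have hne : ∀ x ∈ Set.Icc a b, f x + ε ≠ 0 := fun x hx => (hpos x hx).ne'
  have hcont : ContinuousOn (fun x => f' x ^ 2 / (f x + ε)) (Set.Icc a b) := by
    fun_prop (disch := assumption)
  rw [intervalIntegral.integral_of_le hab.le, restrict_Ioc_eq_restrict_Icc,
    ofReal_integral_eq_lintegral_ofReal hcont.integrableOn_Icc
      (ae_restrict_of_forall_mem measurableSet_Icc fun x hx =>
        div_nonneg (sq_nonneg _) (hpos x hx).le),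
    ← restrict_Ioo_eq_restrict_Icc]
  refine setLIntegral_mono_ae' measurableSet_Ioo (Filter.Eventually.of_forall fun x hx => ?_)
  refine ENNReal.ofReal_le_ofReal ?_
  have hx' := Set.Ioo_subset_Icc_self hx
  rcases (hnn x hx').eq_or_lt with h0 | h0
  · have hmin : IsLocalMin f x := by
      filter_upwards [Icc_mem_nhds hx.1 hx.2] with y hy
      rw [← h0]; exact hnn y hy
    simp [hmin.hasDerivAt_eq_zero (hf x)]
  · gcongr
    linarith

open Filter Topology in
theorem corollary2p5 (a b : ℝ) (hab : a < b) (f : ℝ → ℝ)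
    (hf : ContDiffOn ℝ 1 f (Set.Icc a b))
    (hf_nonneg : ∀ x ∈ Set.Icc a b, 0 ≤ f x)
    (m : ℝ) (hmean : 1 / (b - a) * (∫ x in a..b, f x) = m) (hm : 0 < m) :
    ENNReal.ofReal (2 * Real.pi ^ 2 / (b - a) ^ 2 *
        ((∫ x in a..b, f x * Real.log (f x)) - (b - a) * (m * Real.log m))) ≤
      ∫⁻ x in Set.Icc a b, ENNReal.ofReal (derivWithin f (Set.Icc a b) x ^ 2 / f x) := by
  obtain ⟨F, F', hF, hF', hFf, hFd⟩ := exists_hasDerivAt_extension hab hf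
  have cF : Continuous F := continuous_iff_continuousAt.2 fun x => (hF x).continuousAt
  have hnn : ∀ x ∈ Set.Icc a b, 0 ≤ F x := fun x hx => by rw [hFf x hx]; exact hf_nonneg x hx
  have hu : ∀ x ∈ Set.uIcc a b, F x = f x := by rwa [Set.uIcc_of_le hab.le]
  have e1 : ∫ x in a..b, f x = ∫ x in a..b, F x :=
    intervalIntegral.integral_congr fun x hx => (hu x hx).symm
  have e2 : ∫ x in a..b, f x * Real.log (f x) = ∫ x in a..b, F x * Real.log (F x) :=
    intervalIntegral.integral_congr fun x hx => by simp only [hu x hx]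
  have e3 : ∫⁻ x in Set.Icc a b, ENNReal.ofReal (derivWithin f (Set.Icc a b) x ^ 2 / f x)
      = ∫⁻ x in Set.Icc a b, ENNReal.ofReal (F' x ^ 2 / F x) :=
    MeasureTheory.setLIntegral_congr_fun measurableSet_Icc fun x hx => by
      simp only [hFf x hx, hFd x hx]
  rw [e1, one_div] at hmean
  rw [e2, e3]
  let A : ℝ → ℝ := fun ε => 2 * Real.pi ^ 2 / (b - a) ^ 2 *
    ((∫ x in a..b, (F x + ε) * Real.log (F x + ε)) - (b - a) * ((m + ε) * Real.log (m + ε)))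
  have hA : Continuous A := by
    have h1 : Continuous fun ε => ∫ x in a..b, (F x + ε) * Real.log (F x + ε) := by
      refine intervalIntegral.continuous_parametric_intervalIntegral_of_continuous' ?_ a b
      exact Real.continuous_mul_log.comp (f := fun p : ℝ × ℝ => F p.2 + p.1) (by fun_prop)
    have h2 : Continuous fun ε => (m + ε) * Real.log (m + ε) :=
      Real.continuous_mul_log.comp (by fun_prop)
    fun_prop
  have hle : ∀ ε > 0, ENNReal.ofReal (A ε)
      ≤ ∫⁻ x in Set.Icc a b, ENNReal.ofReal (F' x ^ 2 / F x) := fun ε hε => by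
    have h := logSobolev_Icc_of_pos hab (f := fun x => F x + ε) (fun x => (hF x).add_const ε) hF'
      fun x hx => add_pos_of_nonneg_of_pos (hnn x hx) hε
    have em : (b - a)⁻¹ * ∫ x in a..b, (F x + ε) = m + ε := by
      have : b - a ≠ 0 := (sub_pos.2 hab).ne'
      rw [intervalIntegral.integral_add (cF.intervalIntegrable _ _) (by simp), mul_add, hmean,
        intervalIntegral.integral_const, smul_eq_mul, inv_mul_cancel_left₀ this]
    rw [em] at h
    exact (ENNReal.ofReal_le_ofReal h).trans (ofReal_integral_le_lintegral_div hab hF hF' hnn hε)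
  have hlim : Tendsto (fun ε => ENNReal.ofReal (A ε)) (𝓝[>] 0) (𝓝 (ENNReal.ofReal (A 0))) :=
    (ENNReal.continuous_ofReal.comp hA).continuousWithinAt
  have := le_of_tendsto hlim (eventually_mem_nhdsWithin.mono hle)
  simpa [A] using this
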